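/- Let $n\ge 1$ and let $A=(a_{ij})$ be an $n\times n$ real nonnegative irreducible matrix, i.e. the digraph $D_A$ on $\{1,\dots,n\}$ with an arc $(i,j)$ whenever $a_{ij}\neq 0$ has, for all vertices $i,j$, a path of positive length from $i$ to $j$ (so the $1\times1$ zero matrix is excluded). Let $p\ge 1$ be the period of $A$, i.e. the greatest common divisor of the lengths of the closed paths of $D_A$. For a real square matrix $M$ let $sp(M)$ denote the multiset of its complex eigenvalues, counted with algebraic multiplicity, and let $|M|$ be the matrix of absolute values of its entries. A signing of $A$ is a real matrix $B$ with $|B|=A$. For $\alpha\in\mathbb{C}$ with $|\alpha|=1$ let $\mathcal{M}(\alpha,A)$ be the set of all signings $B$ of $A$ with $sp(B)=\alpha\, sp(A)$, as multisets. Two real matrices $M,N$ are $\{-1,1\}$-diagonally similar if $N=\Lambda^{-1}M\Lambda$ for some diagonal matrix $\Lambda$ with all diagonal entries in $\{-1,1\}$. Then: (i) For every $\alpha\in\mathbb{C}$ with $|\alpha|=1$, $\mathcal{M}(\alpha,A)$ is nonempty if and only if $\alpha=e^{i\pi k/p}$ for some $k\in\{0,\dots,2p-1\}$. (ii) Let $k\in\{0,\dots,2p-1\}$.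 (a) If $k$ is even, then $\mathcal{M}(e^{i\pi k/p},A)$ is the set of all matrices $\{-1,1\}$-diagonally similar to $A$. (b) If $k$ is odd, then for every signing $B_0$ of $A$ with $sp(B_0)=e^{i\pi/p}\,sp(A)$, $\mathcal{M}(e^{i\pi k/p},A)$ is the set of all matrices $\{-1,1\}$-diagonally similar to $B_0$. -/

import Mathlib

namespace SigningSpectra

/-- The period of a nonnegative matrix `A`: the greatest common divisor of the lengths of the
closed paths of its digraph `A.toQuiver` (an arc `i ⟶ j` for each entry `0 < A i j`), taken
literally as the largest natural number dividing all these lengths.  (Paths of length `0` are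
allowed; they are divisible by everything and do not matter.) -/
noncomputable def period {n : Type*} (A : Matrix n n ℝ) : ℕ :=
  letI := A.toQuiver
  sSup {d : ℕ | ∀ (i : n) (c : Quiver.Path i i), d ∣ c.length}

/-- The spectrum of a real matrix: the multiset of its complex eigenvalues, each counted with its
algebraic multiplicity. -/
noncomputable def sp {n : Type*} [Fintype n] [DecidableEq n] (A : Matrix n n ℝ) : Multiset ℂ :=
  (A.map Complex.ofReal).charpoly.roots

/-- `B` is a signing of `A` if `|B| = A`, with the absolute value taken entrywise. -/
def IsSigning {n : Type*} (A B : Matrix n n ℝ) : Prop :=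
  B.map (fun x => |x|) = A

/-- The set `M(α, A)` of all signings `B` of `A` such that `sp(B) = α sp(A)` as multisets. -/
def signingSet {n : Type*} [Fintype n] [DecidableEq n] (α : ℂ) (A : Matrix n n ℝ) :
    Set (Matrix n n ℝ) :=
  {B | IsSigning A B ∧ sp B = (sp A).map (fun z => α * z)}

/-- `A` and `B` are `{-1, 1}`-diagonally similar: `B = Λ⁻¹ A Λ` for a diagonal matrix `Λ` with
diagonal entries in `{-1, 1}`. -/
def SignDiagSimilar {n : Type*} [Fintype n] [DecidableEq n] (A B : Matrix n n ℝ) : Prop :=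
  ∃ d : n → ℝ, (∀ i, d i ∈ ({-1, 1} : Set ℝ)) ∧
    B = (Matrix.diagonal d)⁻¹ * A * Matrix.diagonal d

end SigningSpectra

namespace SigningSpectra

/-! If `sp B = α sp(A)` then `tr B^m = α^m tr A^m` for all `m`. Since `|B| = A`, the entries of
`B^m` are bounded by those of `A^m`, so when `tr A^m > 0` the triangle inequality is an equality:
every closed path of length `m` has `B`-weight `α^m` times its `A`-weight
(`pathWeight_closed_of_mem_signingSet`). These weights are real, so `α^(2m) = 1` for every closed
length `m`, hence `α^(2p) = 1`. As `p ∣ m`, the signs on closed paths depend only on `α^p`, and by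
irreducibility they fix a signing up to diagonal similarity.

Conversely, let `α^(2p) = 1`. With levels `h` that rise by one mod `p` along arcs, conjugating `α A`
by the diagonal matrix of the `α^(h i)` multiplies each entry by a power of `α^p = ±1`, which gives
a signing; it is `A` itself if `α^p = 1`. The parity of `k` is the sign of `α^p = (-1)^k`. -/

open Matrix Polynomial

/-! ### Spectra, traces of powers and diagonal similarity -/

section Charpoly

variable {n : Type*} [Fintype n] [DecidableEq n]

/-- The determinant of a polynomial in a matrix only depends on the characteristic polynomial. -/
theorem det_aeval_eq_of_charpoly_eq {K : Type*} [Field K] [IsAlgClosed K] {M N : Matrix n n K}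
    (h : M.charpoly = N.charpoly) (q : K[X]) : (aeval M q).det = (aeval N q).det := by
  have hq : q.Splits := IsAlgClosed.splits q
  induction hq using Submonoid.closure_induction with
  | mem q hq =>
    rcases hq with ⟨a, rfl⟩ | ⟨a, rfl⟩
    · simp [Algebra.algebraMap_eq_smul_one]
    · have key (L : Matrix n n K) :
          (aeval L (X + C a)).det = (-1) ^ Fintype.card n * L.charpoly.eval (-a) := by
        rw [eval_charpoly, ← det_neg]
        congr 1
        ext i j
        by_cases hij : i = j <;>
          simp [Algebra.algebraMap_eq_smul_one, Matrix.scalar_apply, hij, add_comm]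
      rw [key, key, h]
  | one => simp
  | mul p q _ _ hp hq => simp [hp, hq]

theorem trace_pow_eq_of_charpoly_eq {K : Type*} [Field K] [IsAlgClosed K] {M N : Matrix n n K}
    (h : M.charpoly = N.charpoly) (m : ℕ) : (M ^ m).trace = (N ^ m).trace := by
  have key : (M ^ m).charpoly = (N ^ m).charpoly := by
    refine Polynomial.funext fun z => ?_
    -- At `M` this polynomial has determinant `det (z - M^m)`, the value at `z` of the
    -- characteristic polynomial of `M^m`.
    have := det_aeval_eq_of_charpoly_eq h (C z - X ^ m)
    simpa [eval_charpoly, Algebra.algebraMap_eq_smul_one, Matrix.scalar_apply,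
      Matrix.smul_one_eq_diagonal] using this
  rw [trace_eq_sum_roots_charpoly, trace_eq_sum_roots_charpoly, key]

theorem roots_charpoly_smul {K : Type*} [Field K] [IsAlgClosed K] (M : Matrix n n K) {a : K}
    (ha : a ≠ 0) : (a • M).charpoly.roots = M.charpoly.roots.map (fun z => a * z) := by
  have hM : M.charpoly = (M.charpoly.roots.map (fun r => X - C r)).prod :=
    (IsAlgClosed.splits _).eq_prod_roots_of_monic M.charpoly_monic
  have hc : Multiset.card M.charpoly.roots = Fintype.card n := by
    rw [← (IsAlgClosed.splits M.charpoly).natDegree_eq_card_roots, charpoly_natDegree_eq_dim]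
  have key : (a • M).charpoly =
      ((M.charpoly.roots.map (fun z => a * z)).map (fun r => X - C r)).prod := by
    refine Polynomial.funext fun z => ?_
    have h1 : (a • M).charpoly.eval z = a ^ Fintype.card n * M.charpoly.eval (z / a) := by
      rw [eval_charpoly, eval_charpoly, ← det_smul]
      congr 1
      ext i j
      by_cases hij : i = j
      · subst hij
        simp [Matrix.scalar_apply, mul_sub, mul_div_cancel₀ _ ha]
      · simp [Matrix.scalar_apply, hij]
    rw [h1, hM, ← hc, eval_multiset_prod, eval_multiset_prod, ← hM, Multiset.map_map,
      Multiset.map_map, Multiset.map_map, ← Multiset.prod_replicate,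
      ← Multiset.map_const', ← Multiset.prod_map_mul]
    congr 1
    refine Multiset.map_congr rfl fun r _ => ?_
    simp [mul_sub, mul_div_cancel₀ _ ha]
  rw [key, roots_multiset_prod_X_sub_C]

/-- If `N` is diagonally similar to `a • M`, then the eigenvalues of `N` are those of `M`
multiplied by `a`. -/
theorem roots_charpoly_of_diagonal_conj {K : Type*} [Field K] [IsAlgClosed K]
    {M N : Matrix n n K} {a : K} (ha : a ≠ 0) {d : n → K} (hd : ∀ i, d i ≠ 0)
    (h : ∀ i j, N i j * d j = d i * (a * M i j)) :
    N.charpoly.roots = M.charpoly.roots.map (fun z => a * z) := by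
  let D : (Matrix n n K)ˣ :=
    ⟨diagonal d, diagonal fun i => (d i)⁻¹, by simp [diagonal_mul_diagonal, hd],
      by simp [diagonal_mul_diagonal, hd]⟩
  have hN : N = D.val * (a • M) * D⁻¹.val := by
    rw [Units.eq_mul_inv_iff_mul_eq]
    ext i j
    simpa [D, mul_diagonal, diagonal_mul] using h i j
  rw [hN, coe_units_inv, charpoly_units_conj, roots_charpoly_smul M ha]

theorem sp_of_diagonal_conj {A B : Matrix n n ℝ} {α : ℂ} (hα : α ≠ 0) {d : n → ℂ}
    (hd : ∀ i, d i ≠ 0) (h : ∀ i j, (B i j : ℂ) * d j = d i * (α * A i j)) :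
    sp B = (sp A).map (fun z => α * z) :=
  roots_charpoly_of_diagonal_conj hα hd h

theorem trace_pow_of_sp_eq {A B : Matrix n n ℝ} {α : ℂ} (hα : α ≠ 0)
    (h : sp B = (sp A).map (fun z => α * z)) (m : ℕ) :
    ((B ^ m).trace : ℂ) = α ^ m * (A ^ m).trace := by
  have hc : (B.map Complex.ofReal).charpoly = (α • A.map Complex.ofReal).charpoly := by
    rw [(IsAlgClosed.splits _).eq_prod_roots_of_monic (charpoly_monic (B.map Complex.ofReal)),
      (IsAlgClosed.splits _).eq_prod_roots_of_monic (charpoly_monic (α • A.map Complex.ofReal)),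
      roots_charpoly_smul _ hα]
    exact congrArg (fun s => (s.map fun r => X - C r).prod) h
  have hm (M : Matrix n n ℝ) : ((M ^ m).trace : ℂ) = ((M.map Complex.ofReal) ^ m).trace := by
    have : (M.map Complex.ofReal) ^ m = (M ^ m).map Complex.ofReal :=
      (map_pow Complex.ofRealHom.mapMatrix M m).symm
    simp [this, Matrix.trace]
  rw [hm, hm, trace_pow_eq_of_charpoly_eq hc, _root_.smul_pow, trace_smul, smul_eq_mul]

theorem signDiagSimilar_iff {A B : Matrix n n ℝ} :
    SignDiagSimilar A B ↔
      ∃ d : n → ℝ, (∀ i, |d i| = 1) ∧ ∀ i j, B i j * d j = d i * A i j := by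
  refine exists_congr fun d => ?_
  have hd : (∀ i, d i ∈ ({-1, 1} : Set ℝ)) ↔ ∀ i, |d i| = 1 := by
    simp only [Set.mem_insert_iff, Set.mem_singleton_iff, abs_eq zero_le_one]
    exact forall_congr' fun i => or_comm
  rw [hd]
  refine and_congr_right fun h1 => ?_
  have hsq (i : n) : d i * d i = 1 := by rw [← abs_mul_abs_self, h1, one_mul]
  have hinv : (diagonal d)⁻¹ = diagonal d :=
    inv_eq_left_inv (by simp [diagonal_mul_diagonal, hsq])
  rw [hinv, ← Matrix.ext_iff]
  refine forall_congr' fun i => forall_congr' fun j => ?_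
  rw [mul_diagonal, diagonal_mul]
  constructor
  · intro h
    rw [h, mul_assoc, hsq, mul_one]
  · intro h
    rw [← h, mul_assoc, hsq, mul_one]

end Charpoly

/-! ### Path weights of signings -/

section Signing

variable {n : Type*} {A B C : Matrix n n ℝ}

theorem IsSigning.abs_apply (h : IsSigning A B) (i j : n) : |B i j| = A i j :=
  congrFun (congrFun h i) j

/-- The product of the entries of `B` along a path of the digraph of `A`. -/
noncomputable def pathWeight (A B : Matrix n n ℝ) {i j : n} (c : @Quiver.Path n A.toQuiver i j) :
    ℝ :=
  letI := A.toQuiver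
  Quiver.Path.weightOfEPs (fun i j => B i j) c

theorem pathWeight_nil (A B : Matrix n n ℝ) (i : n) :
    letI := A.toQuiver
    pathWeight A B (Quiver.Path.nil : Quiver.Path i i) = 1 :=
  let := A.toQuiver
  Quiver.Path.weightOfEPs_nil _ i

theorem pathWeight_cons (A B : Matrix n n ℝ) {i j k : n} (c : @Quiver.Path n A.toQuiver i j)
    (e : A.toQuiver.Hom j k) :
    letI := A.toQuiver
    pathWeight A B (c.cons e) = pathWeight A B c * B j k :=
  let := A.toQuiver
  Quiver.Path.weightOfEPs_cons _ c e

theorem pathWeight_comp (A B : Matrix n n ℝ) {i j k : n} (c : @Quiver.Path n A.toQuiver i j)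
    (q : @Quiver.Path n A.toQuiver j k) :
    letI := A.toQuiver
    pathWeight A B (c.comp q) = pathWeight A B c * pathWeight A B q :=
  let := A.toQuiver
  Quiver.Path.weightOfEPs_comp _ c q

theorem IsSigning.abs_pathWeight (h : IsSigning A B) {i j : n}
    (c : @Quiver.Path n A.toQuiver i j) : |pathWeight A B c| = pathWeight A A c := by
  let := A.toQuiver
  induction c with
  | nil => rw [pathWeight_nil, pathWeight_nil, abs_one]
  | cons q e ih => rw [pathWeight_cons, pathWeight_cons, abs_mul, ih, h.abs_apply]

theorem pathWeight_self_pos {i j : n} (c : @Quiver.Path n A.toQuiver i j) :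
    0 < pathWeight A A c := by
  let := A.toQuiver
  induction c with
  | nil => rw [pathWeight_nil]; exact one_pos
  | cons q e ih => rw [pathWeight_cons]; exact mul_pos ih e.down

theorem IsSigning.pathWeight_ne_zero (h : IsSigning A B) {i j : n}
    (c : @Quiver.Path n A.toQuiver i j) : pathWeight A B c ≠ 0 := by
  rw [← abs_pos, h.abs_pathWeight]
  exact pathWeight_self_pos c

variable [Fintype n] [DecidableEq n]

theorem IsSigning.of_signDiagSimilar (h : IsSigning A B) (hBC : SignDiagSimilar B C) :
    IsSigning A C := by
  obtain ⟨d, hd, hC⟩ := signDiagSimilar_iff.1 hBC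
  ext i j
  have := congrArg abs (hC i j)
  rw [abs_mul, abs_mul, hd, hd, mul_one, one_mul, h.abs_apply] at this
  exact this

theorem sp_eq_of_signDiagSimilar (h : SignDiagSimilar A B) : sp B = sp A := by
  obtain ⟨d, hd, hB⟩ := signDiagSimilar_iff.1 h
  have := sp_of_diagonal_conj (A := A) (B := B) one_ne_zero (d := fun i => (d i : ℂ))
    (fun i => by
      have : d i ≠ 0 := abs_pos.1 (by rw [hd]; exact one_pos)
      exact_mod_cast this)
    (fun i j => by rw [one_mul]; exact_mod_cast hB i j)
  simpa using this

theorem self_mem_signingSet_one (hA : A.IsIrreducible) : A ∈ signingSet 1 A :=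
  ⟨by ext i j; simp [abs_of_nonneg (hA.nonneg i j)], by simp⟩

theorem IsSigning.abs_pow_apply_le (h : IsSigning A B) (m : ℕ) (i j : n) :
    |(B ^ m) i j| ≤ (A ^ m) i j := by
  induction m generalizing j with
  | zero => by_cases hij : i = j <;> simp [hij]
  | succ m ih =>
    rw [pow_succ, pow_succ, mul_apply, mul_apply]
    refine (Finset.abs_sum_le_sum_abs _ _).trans (Finset.sum_le_sum fun l _ => ?_)
    rw [abs_mul, h.abs_apply]
    exact mul_le_mul_of_nonneg_right (ih l) (h.abs_apply l j ▸ abs_nonneg _)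

/-- If an entry of `B ^ m` attains the bound by the entry of `A ^ m` up to the sign `ε`,
then all paths that contribute to it have the sign `ε`. -/
theorem IsSigning.pathWeight_eq_of_pow_apply_eq (h : IsSigning A B) {i j : n}
    (c : @Quiver.Path n A.toQuiver i j) {ε : ℝ} (hε : |ε| = 1)
    (hc : letI := A.toQuiver; (B ^ c.length) i j = ε * (A ^ c.length) i j) :
    pathWeight A B c = ε * pathWeight A A c := by
  let := A.toQuiver
  induction c generalizing ε with
  | nil => simpa [pathWeight_nil] using hc
  | @cons l j q e ih =>
    have hεε : ε * ε = 1 := by rw [← abs_mul_abs_self, hε, one_mul]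
    have he : 0 < A l j := e.down
    simp only [Quiver.Path.length_cons, pow_succ, mul_apply] at hc
    have hle (l' : n) : ε * ((B ^ q.length) i l' * B l' j) ≤ (A ^ q.length) i l' * A l' j := by
      refine (le_abs_self _).trans ?_
      rw [abs_mul, hε, one_mul, abs_mul, h.abs_apply]
      exact mul_le_mul_of_nonneg_right (h.abs_pow_apply_le _ _ _)
        (h.abs_apply l' j ▸ abs_nonneg _)
    have hsum : ∑ l', ε * ((B ^ q.length) i l' * B l' j) =
        ∑ l', (A ^ q.length) i l' * A l' j := by
      rw [← Finset.mul_sum, hc, ← mul_assoc, hεε, one_mul]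
    -- Equal sums with termwise inequality force equality at the penultimate vertex `l`; the path
    -- without its last arc then has sign `ε * s`, with `s` the sign of that arc.
    have hl := (Finset.sum_eq_sum_iff_of_le fun l' _ => hle l').1 hsum l (Finset.mem_univ l)
    set s := B l j / A l j with hs
    have hB : B l j = s * A l j := by rw [hs, div_mul_cancel₀ _ he.ne']
    have hs1 : |s| = 1 := by rw [hs, abs_div, h.abs_apply, abs_of_pos he, div_self he.ne']
    have hss : s * s = 1 := by rw [← abs_mul_abs_self, hs1, one_mul]
    have h2 : ε * ((B ^ q.length) i l * s) = (A ^ q.length) i l := by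
      refine mul_right_cancel₀ he.ne' ?_
      rw [← hl, hB]
      ring
    have h3 := ih (ε := ε * s) (by rw [abs_mul, hε, hs1, one_mul])
      (by
        rw [← h2]
        linear_combination (-(B ^ q.length) i l * s * s) * hεε - (B ^ q.length) i l * hss)
    rw [pathWeight_cons, pathWeight_cons, h3, hB]
    linear_combination (ε * pathWeight A A q * A l j) * hss

/-- The sign of a closed path of a signing with spectrum `α sp(A)` is determined by its length. -/
theorem pathWeight_closed_of_mem_signingSet {α : ℂ} (hα : ‖α‖ = 1)
    (hB : B ∈ signingSet α A) {i : n} (c : @Quiver.Path n A.toQuiver i i) :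
    letI := A.toQuiver
    (pathWeight A B c : ℂ) = α ^ c.length * pathWeight A A c := by
  let := A.toQuiver
  obtain ⟨hs, hsp⟩ := hB
  have hα0 : α ≠ 0 := norm_pos_iff.1 (by rw [hα]; exact one_pos)
  have hA (i j : n) : 0 ≤ A i j := hs.abs_apply i j ▸ abs_nonneg _
  set m := c.length with hm
  have hii : 0 < (A ^ m) i i :=
    (pow_apply_pos_iff_nonempty_path hA m i i).2 ⟨⟨c, rfl⟩⟩
  have htr : 0 < (A ^ m).trace :=
    Finset.sum_pos' (fun j _ => pow_apply_nonneg hA m j j) ⟨i, Finset.mem_univ i, hii⟩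
  have ht := trace_pow_of_sp_eq hα0 hsp m
  set ε := (B ^ m).trace / (A ^ m).trace with hεdef
  have hεα : (ε : ℂ) = α ^ m := by
    have : ((A ^ m).trace : ℂ) ≠ 0 := by exact_mod_cast htr.ne'
    rw [hεdef, Complex.ofReal_div, ht, mul_div_cancel_right₀ _ this]
  have hε : |ε| = 1 := by
    rw [← Real.norm_eq_abs, ← Complex.norm_real, hεα, norm_pow, hα, one_pow]
  have hεε : ε * ε = 1 := by rw [← abs_mul_abs_self, hε, one_mul]
  have hle (j : n) : ε * (B ^ m) j j ≤ (A ^ m) j j := by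
    refine (le_abs_self _).trans ?_
    rw [abs_mul, hε, one_mul]
    exact hs.abs_pow_apply_le _ _ _
  have hsum : ∑ j, ε * (B ^ m) j j = ∑ j, (A ^ m) j j := by
    have : (B ^ m).trace = ε * (A ^ m).trace := by rw [hεdef, div_mul_cancel₀ _ htr.ne']
    rw [← Finset.mul_sum]
    change ε * (B ^ m).trace = (A ^ m).trace
    rw [this, ← mul_assoc, hεε, one_mul]
  have hl := (Finset.sum_eq_sum_iff_of_le fun j _ => hle j).1 hsum i (Finset.mem_univ i)
  have := hs.pathWeight_eq_of_pow_apply_eq c hε (by rw [← hm, ← hl, ← mul_assoc, hεε, one_mul])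
  rw [this, ← hεα]
  push_cast
  rfl

/-- Two signings with the same signs on closed paths are `{-1, 1}`-diagonally similar. -/
theorem signDiagSimilar_of_pathWeight_closed_eq [Nonempty n] (hA : A.IsIrreducible)
    (hB : IsSigning A B) (hC : IsSigning A C)
    (h : ∀ (i : n) (c : @Quiver.Path n A.toQuiver i i), pathWeight A B c = pathWeight A C c) :
    SignDiagSimilar B C := by
  let := A.toQuiver
  obtain ⟨r⟩ := ‹Nonempty n›
  choose P _ using hA.connected r
  choose Q _ using fun i => hA.connected i r
  -- A potential: the relative sign of `B` and `C` along a chosen path from the root. Closing up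
  -- through a return path shows that the choice does not matter.
  refine signDiagSimilar_iff.2 ⟨fun i => pathWeight A B (P i) / pathWeight A C (P i), ?_, ?_⟩
  · intro i
    rw [abs_div, hB.abs_pathWeight, hC.abs_pathWeight, div_self (pathWeight_self_pos _).ne']
  · intro i j
    rcases (hA.nonneg i j).eq_or_lt with h0 | hpos
    · have hB0 : B i j = 0 := by rw [← abs_eq_zero, hB.abs_apply, h0]
      have hC0 : C i j = 0 := by rw [← abs_eq_zero, hC.abs_apply, h0]
      rw [hB0, hC0, zero_mul, mul_zero]
    · let e : i ⟶ j := ⟨hpos⟩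
      have h1 := h r (((P i).cons e).comp (Q j))
      have h2 := h r ((P j).comp (Q j))
      rw [pathWeight_comp, pathWeight_comp, pathWeight_cons, pathWeight_cons] at h1
      rw [pathWeight_comp, pathWeight_comp] at h2
      have nCi := hC.pathWeight_ne_zero (P i)
      have nCj := hC.pathWeight_ne_zero (P j)
      have nQC := hC.pathWeight_ne_zero (Q j)
      have nQB := hB.pathWeight_ne_zero (Q j)
      field_simp
      refine mul_right_cancel₀ nQB ?_
      linear_combination (C i j * pathWeight A C (P i)) * h2 - pathWeight A C (P j) * h1

end Signing

/-! ### The period and the cyclic levels -/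

section Period

variable {n : Type*} {A : Matrix n n ℝ} [Nonempty n]

/-- A closed path of positive length gives the bound; without one, the `sSup` in `period` would take
its default value. -/
theorem bddAbove_commonDivisors (hA : A.IsIrreducible) :
    BddAbove {d : ℕ | letI := A.toQuiver; ∀ (i : n) (c : Quiver.Path i i), d ∣ c.length} := by
  let := A.toQuiver
  obtain ⟨r⟩ := ‹Nonempty n›
  obtain ⟨c, hc⟩ := hA.connected r r
  exact ⟨c.length, fun d hd => Nat.le_of_dvd hc (hd r c)⟩

theorem period_dvd_length (hA : A.IsIrreducible) {i : n} (c : @Quiver.Path n A.toQuiver i i) :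
    letI := A.toQuiver
    period A ∣ c.length := by
  let := A.toQuiver
  have hne : {d : ℕ | ∀ (i : n) (c : Quiver.Path i i), d ∣ c.length}.Nonempty :=
    ⟨1, fun _ _ => one_dvd _⟩
  exact Nat.sSup_mem hne (bddAbove_commonDivisors hA) i c

theorem period_pos (hA : A.IsIrreducible) : 0 < period A :=
  le_csSup (bddAbove_commonDivisors hA) (a := 1) fun _ _ => one_dvd _

/-- The lcm of two common divisors is again one, so the largest is divisible by all. -/
theorem dvd_period (hA : A.IsIrreducible) {d : ℕ}
    (hd : letI := A.toQuiver; ∀ (i : n) (c : Quiver.Path i i), d ∣ c.length) : d ∣ period A := by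
  have h1 : Nat.lcm d (period A) ≤ period A :=
    le_csSup (bddAbove_commonDivisors hA) fun i c =>
      Nat.lcm_dvd (hd i c) (period_dvd_length hA c)
  have h3 : Nat.lcm d (period A) = period A :=
    le_antisymm h1 (Nat.le_of_dvd (Nat.pos_of_ne_zero fun h0 => by
      rcases Nat.lcm_eq_zero_iff.1 h0 with h | h
      · subst h
        let := A.toQuiver
        obtain ⟨r⟩ := ‹Nonempty n›
        obtain ⟨c, hc⟩ := hA.connected r r
        have := hd r c
        rw [zero_dvd_iff] at this
        omega
      · exact (period_pos hA).ne' h) (Nat.dvd_lcm_right _ _))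
  exact h3 ▸ Nat.dvd_lcm_left d (period A)

/-- The vertices have levels such that each arc raises the level by one modulo the period. -/
theorem exists_level (hA : A.IsIrreducible) :
    ∃ h : n → ℤ, ∀ i j, 0 < A i j → (period A : ℤ) ∣ h i + 1 - h j := by
  let := A.toQuiver
  have hne := ‹Nonempty n›
  obtain ⟨r⟩ := hne
  choose P _ using hA.connected r
  choose Q _ using fun i => hA.connected i r
  -- Two closed paths with the same return from `j`, one through the arc and one along `P j`, differ
  -- in length by `h i + 1 - h j`.
  refine ⟨fun i => (P i).length, fun i j hij => ?_⟩
  let e : i ⟶ j := ⟨hij⟩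
  have h1 := period_dvd_length hA (((P i).cons e).comp (Q j))
  have h2 := period_dvd_length hA ((P j).comp (Q j))
  rw [Quiver.Path.length_comp, Quiver.Path.length_cons] at h1
  rw [Quiver.Path.length_comp] at h2
  have h3 := dvd_sub (Int.natCast_dvd_natCast.2 h1) (Int.natCast_dvd_natCast.2 h2)
  push_cast at h3
  rwa [add_sub_add_right_eq_sub] at h3

end Period

/-! ### Admissible `α` and the similarity classes -/

section Main

variable {n : Type*} [Fintype n] [DecidableEq n] [Nonempty n] {A B C : Matrix n n ℝ}

theorem pow_period_sq_eq_one (hA : A.IsIrreducible) {α : ℂ} (hα : ‖α‖ = 1)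
    (hB : B ∈ signingSet α A) : (α ^ 2) ^ period A = 1 := by
  let := A.toQuiver
  refine orderOf_dvd_iff_pow_eq_one.1 (dvd_period hA fun i c => orderOf_dvd_of_pow_eq_one ?_)
  have h1 := pathWeight_closed_of_mem_signingSet hα hB c
  have h2 : pathWeight A B c ^ 2 = pathWeight A A c ^ 2 := by
    rw [← sq_abs, hB.1.abs_pathWeight]
  have h3 : (pathWeight A A c : ℂ) ^ 2 ≠ 0 := by
    exact_mod_cast pow_ne_zero 2 (pathWeight_self_pos c).ne'
  refine mul_right_cancel₀ h3 ?_
  have h4 : (pathWeight A B c : ℂ) ^ 2 = (pathWeight A A c : ℂ) ^ 2 := by exact_mod_cast h2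
  rw [h1, mul_pow] at h4
  rw [one_mul, pow_right_comm, h4]

theorem signDiagSimilar_of_mem_signingSet (hA : A.IsIrreducible) {α β : ℂ} (hα : ‖α‖ = 1)
    (hβ : ‖β‖ = 1) (h : α ^ period A = β ^ period A) (hB : B ∈ signingSet α A)
    (hC : C ∈ signingSet β A) : SignDiagSimilar B C := by
  let := A.toQuiver
  refine signDiagSimilar_of_pathWeight_closed_eq hA hB.1 hC.1 fun i c => ?_
  have h1 := pathWeight_closed_of_mem_signingSet hα hB c
  have h2 := pathWeight_closed_of_mem_signingSet hβ hC c
  obtain ⟨t, ht⟩ := period_dvd_length hA c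
  rw [ht, pow_mul, h, ← pow_mul, ← ht, ← h2] at h1
  exact_mod_cast h1

/-- If `α ^ (2 * period A) = 1`, the entries of `A` can be signed so that `A` becomes diagonally
similar to `α • A`; the signs are trivial when `α ^ period A = 1`. -/
theorem exists_mem_signingSet (hA : A.IsIrreducible) {α : ℂ} (hα : (α ^ 2) ^ period A = 1) :
    ∃ B ∈ signingSet α A, α ^ period A = 1 → B = A := by
  obtain ⟨h, hh⟩ := exists_level hA
  have hα0 : α ≠ 0 := by
    rintro rfl
    simp [(period_pos hA).ne'] at hα
  have hsign : α ^ period A = 1 ∨ α ^ period A = -1 := by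
    rw [← sq_eq_one_iff, ← pow_mul, mul_comm, pow_mul, hα]
  have hs : ∀ i j, ∃ s : ℝ, |s| = 1 ∧ (α ^ period A = 1 → s = 1) ∧
      (0 < A i j → (s : ℂ) * α ^ h j = α ^ h i * α) := by
    intro i j
    by_cases hij : 0 < A i j
    · obtain ⟨t, ht⟩ := hh i j hij
      have key : α ^ h i * α = (α ^ period A) ^ t * α ^ h j := by
        rw [← zpow_natCast, ← _root_.zpow_mul, ← ht, ← zpow_add₀ hα0, ← zpow_add_one₀ hα0]
        congr 1
        ring
      rcases hsign with h1 | h1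
      · exact ⟨1, abs_one, fun _ => rfl, fun _ => by rw [key, h1, _root_.one_zpow, Complex.ofReal_one]⟩
      · refine ⟨(-1) ^ t, by rw [abs_zpow]; simp, fun h2 => ?_, fun _ => ?_⟩
        · rw [h1] at h2
          norm_num at h2
        · rw [key, h1]
          push_cast
          rfl
    · exact ⟨1, abs_one, fun _ => rfl, fun h => absurd h hij⟩
  choose s hs1 hs2 hs3 using hs
  refine ⟨Matrix.of fun i j => s i j * A i j, ⟨?_, ?_⟩, fun h1 => ?_⟩
  · ext i j
    simp [abs_mul, hs1, abs_of_nonneg (hA.nonneg i j)]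
  · refine sp_of_diagonal_conj hα0 (d := fun i => α ^ h i) (fun i => zpow_ne_zero _ hα0) ?_
    intro i j
    rcases (hA.nonneg i j).eq_or_lt with h0 | hpos
    · simp [← h0]
    · simp only [of_apply]
      push_cast
      linear_combination (A i j : ℂ) * hs3 i j hpos
  · ext i j
    simp [hs2 i j h1]

/-- The signing built for `ω` has only trivial signs, so `A` itself lies in `signingSet ω A`. -/
theorem sp_map_mul_of_pow_period_eq_one (hA : A.IsIrreducible) {ω : ℂ} (hω : ω ^ period A = 1) :
    (sp A).map (fun z => ω * z) = sp A := by
  obtain ⟨B, hB, hBA⟩ := exists_mem_signingSet hA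
    (α := ω) (by rw [← pow_mul, mul_comm, pow_mul, hω, one_pow])
  rw [← hB.2, hBA hω]

theorem mem_signingSet_of_signDiagSimilar (hA : A.IsIrreducible) {α β : ℂ} (hβ : β ≠ 0)
    (h : α ^ period A = β ^ period A) (hB : B ∈ signingSet β A) (hBC : SignDiagSimilar B C) :
    C ∈ signingSet α A := by
  refine ⟨hB.1.of_signDiagSimilar hBC, ?_⟩
  have hω : (α / β) ^ period A = 1 := by rw [div_pow, h, div_self (pow_ne_zero _ hβ)]
  rw [sp_eq_of_signDiagSimilar hBC, hB.2]
  -- Rotational symmetry of `sp A` by `α / β` turns the factor `β` into `α`.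
  conv_lhs => rw [← sp_map_mul_of_pow_period_eq_one hA hω]
  rw [Multiset.map_map]
  refine Multiset.map_congr rfl fun z _ => ?_
  simp only [Function.comp_apply]
  field_simp

theorem signingSet_eq_of_mem (hA : A.IsIrreducible) {α β : ℂ} (hα : ‖α‖ = 1) (hβ : ‖β‖ = 1)
    (h : α ^ period A = β ^ period A) (hB : B ∈ signingSet β A) :
    signingSet α A = {C | SignDiagSimilar B C} :=
  Set.ext fun _ =>
    ⟨fun hC => signDiagSimilar_of_mem_signingSet hA hβ hα h.symm hB hC,
      fun hC => mem_signingSet_of_signDiagSimilar hA (norm_pos_iff.1 (by rw [hβ]; exact one_pos))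
        h hB hC⟩

theorem exp_pi_mul_div_pow {p : ℕ} (hp : 0 < p) (k : ℕ) :
    Complex.exp (Complex.I * Real.pi * k / p) ^ p = (-1) ^ k := by
  have hp' : (p : ℂ) ≠ 0 := by exact_mod_cast hp.ne'
  rw [← Complex.exp_nat_mul, ← Complex.exp_pi_mul_I, ← Complex.exp_nat_mul]
  congr 1
  field_simp

theorem norm_exp_pi_mul_div (p k : ℕ) : ‖Complex.exp (Complex.I * Real.pi * k / p)‖ = 1 := by
  have : Complex.I * Real.pi * k / p = ((Real.pi * k / p : ℝ) : ℂ) * Complex.I := by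
    push_cast
    ring
  rw [this, Complex.norm_exp_ofReal_mul_I]

theorem exists_eq_exp_of_pow_eq_one {p : ℕ} (hp : 0 < p) {α : ℂ} (h : (α ^ 2) ^ p = 1) :
    ∃ k ∈ Finset.range (2 * p), α = Complex.exp (Complex.I * Real.pi * k / p) := by
  have hp' : (p : ℂ) ≠ 0 := by exact_mod_cast hp.ne'
  have : NeZero (2 * p) := ⟨by omega⟩
  obtain ⟨k, hk, rfl⟩ := (Complex.isPrimitiveRoot_exp (2 * p) (NeZero.ne _)).eq_pow_of_pow_eq_one
    (ξ := α) (by rw [pow_mul, h])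
  refine ⟨k, Finset.mem_range.2 hk, ?_⟩
  rw [← Complex.exp_nat_mul]
  congr 1
  push_cast
  field_simp

end Main

end SigningSpectra

theorem theorem1 {n : Type*} [Fintype n] [DecidableEq n] [Nonempty n]
    (A : Matrix n n ℝ) (hA : A.IsIrreducible) (p : ℕ) (hp : SigningSpectra.period A = p) :
    (∀ α : ℂ, ‖α‖ = 1 →
      ((SigningSpectra.signingSet α A).Nonempty ↔
        ∃ k ∈ Finset.range (2 * p), α = Complex.exp (Complex.I * Real.pi * k / p))) ∧
    (∀ k ∈ Finset.range (2 * p),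
      (Even k →
        SigningSpectra.signingSet (Complex.exp (Complex.I * Real.pi * k / p)) A =
          {B | SigningSpectra.SignDiagSimilar A B}) ∧
      (Odd k →
        ∀ B₀ : Matrix n n ℝ, SigningSpectra.IsSigning A B₀ →
          SigningSpectra.sp B₀ =
            (SigningSpectra.sp A).map (fun z => Complex.exp (Complex.I * Real.pi / p) * z) →
          SigningSpectra.signingSet (Complex.exp (Complex.I * Real.pi * k / p)) A =
            {B | SigningSpectra.SignDiagSimilar B₀ B})) := by
  open SigningSpectra in
  subst hp
  have hp := period_pos hA
  have hpow := exp_pi_mul_div_pow hp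
  refine ⟨fun α hα => ⟨fun ⟨B, hB⟩ => ?_, ?_⟩, fun k _ => ⟨fun hk => ?_, fun hk B₀ hs hsp => ?_⟩⟩
  · exact exists_eq_exp_of_pow_eq_one hp (pow_period_sq_eq_one hA hα hB)
  · rintro ⟨k, -, rfl⟩
    obtain ⟨B, hB, -⟩ := exists_mem_signingSet hA
      (α := Complex.exp (Complex.I * Real.pi * k / period A))
      (by rw [pow_right_comm, hpow, pow_right_comm, neg_one_sq, one_pow])
    exact ⟨B, hB⟩
  · exact signingSet_eq_of_mem hA (norm_exp_pi_mul_div _ _) norm_one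
      (by rw [hpow, hk.neg_one_pow, one_pow]) (self_mem_signingSet_one hA)
  · have h1 : Complex.exp (Complex.I * Real.pi / period A) =
        Complex.exp (Complex.I * Real.pi * (1 : ℕ) / period A) := by simp
    rw [h1] at hsp
    exact signingSet_eq_of_mem hA (norm_exp_pi_mul_div _ _) (norm_exp_pi_mul_div _ _)
      (by rw [hpow, hpow, hk.neg_one_pow, pow_one]) ⟨hs, hsp⟩
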